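/- Let $(W,S)$ be a Coxeter system, with $m_{st}\in\{1,2,\dots\}\cup\{\infty\}$ the order of $st$ for $s,t\in S$, and let $\mathcal R=\{wsw^{-1} : w\in W,\ s\in S\}$ be its set of reflections. Let $\mathbf k$ be a commutative ring with $1$ and $\underline u=(u_s)_{s\in S}$ a family of elements of $\mathbf k$ such that $u_s=u_t$ whenever $s,t\in S$ are conjugate in $W$. Let $\mathcal C_W(\underline u)$ be the associative unital $\mathbf k$-algebra with generators $g_s$ ($s\in S$), $e_t$ ($t\in\mathcal R$) and relations 1. $g_sg_tg_s\cdots=g_tg_sg_t\cdots$ ($m_{st}$ factors on each side) for $s,t\in S$ with $m_{st}<\infty$; 2. $e_t^2=e_t$ for $t\in\mathcal R$; 3. $e_{t}e_{t'}=e_{t'}e_{t}$ for $t,t'\in\mathcal R$; 4. $e_te_{t'}=e_te_{tt't^{-1}}$ for $t,t'\in\mathcal R$; 5. $g_se_t=e_{sts}g_s$ for $s\in S$, $t\in\mathcal R$; 6. $g_s^2=1+(u_s-1)e_s(1+g_s)$ for $s\in S$. Let $H_W(\underline u)$ be the Iwahori–Hecke algebra: the associative unital $\mathbf k$-algebra with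 generators $T_s$ ($s\in S$), the braid relations as in 1, and $T_s^2=u_s+(u_s-1)T_s$. For $w\in W$ with reduced expression $w=s_1\cdots s_r$ put $g_w=g_{s_1}\cdots g_{s_r}$ and $T_w=T_{s_1}\cdots T_{s_r}$ (the statements below hold for every choice of reduced expression, the same one being used for $g_w$ and $T_w$). For a finite set $J\subset\mathcal R$ put $e_J=\prod_{t\in J}e_t$. (1) There is a unique morphism of unital $\mathbf k$-algebras $\mathfrak p:\mathcal C_W(\underline u)\to H_W(\underline u)$ with $\mathfrak p(g_s)=T_s$ and $\mathfrak p(e_s)=1$ for all $s\in S$. It is surjective; it maps $g_w$ to $T_w$ for every $w\in W$ and $e_J$ to $1$ for every finite $J\subset\mathcal R$. Its kernel is the two-sided ideal generated by the elements $e_s-1$, $s\in S$. (2) Suppose that $S$ is finite, and let $e_S=\prod_{s\in S}e_s$. Then $e_J=e_S$ for every finite set $J\subset\mathcal R$ that generates $W$ (so that $e_S$ may be denoted $e_W$). Moreover $\mathfrak p$ is split: there is a $\mathbf k$-linear multiplicative map $\mathfrak q:H_W(\underline u)\to\mathcal C_W(\underline u)$, not necessarily preserving $1$, such that $\mathfrak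 p\circ\mathfrak q=\mathrm{id}$ and $\mathfrak q(T_w)=g_we_S$ for all $w\in W$. -/

import Mathlib

noncomputable section

namespace ExtHecke

variable {k : Type*} [CommRing k] {B : Type*} {M : CoxeterMatrix B} {W : Type*} [Group W]

/-- The set `R` of reflections of the Coxeter system, i.e. the conjugates of the
simple reflections, as a type. -/
abbrev Refl (cs : CoxeterSystem M W) : Type _ := {t : W // cs.IsReflection t}

/-- The simple reflection `s_i`, as an element of `R`. -/
def simpleRefl (cs : CoxeterSystem M W) (i : B) : Refl cs :=
  ⟨cs.simple i, cs.isReflection_simple i⟩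

/-- The conjugate `w t w⁻¹` of a reflection `t`, as an element of `R`. -/
def conjRefl {cs : CoxeterSystem M W} (w : W) (t : Refl cs) : Refl cs :=
  ⟨w * t.1 * w⁻¹, t.2.conj w⟩

/-! ### The Iwahori-Hecke algebra -/

/-- The defining relations of the Iwahori-Hecke algebra. The braid word of `i` and `j` is the
alternating word of length `M i j` (the order of `s_i s_j`); it is empty if that order is
infinite (encoded by `M i j = 0`), so that there is no relation in this case. -/
inductive HeckeRel (cs : CoxeterSystem M W) (u : B → k) :
    FreeAlgebra k B → FreeAlgebra k B → Prop
  | braid (i j : B) : HeckeRel cs u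
      ((CoxeterSystem.braidWord M i j).map (FreeAlgebra.ι k)).prod
      ((CoxeterSystem.braidWord M j i).map (FreeAlgebra.ι k)).prod
  | quad (i : B) : HeckeRel cs u
      (FreeAlgebra.ι k i ^ 2)
      (algebraMap k _ (u i) + algebraMap k _ (u i - 1) * FreeAlgebra.ι k i)

/-- The Iwahori-Hecke algebra `H_W(u)`. -/
def HeckeAlg (cs : CoxeterSystem M W) (u : B → k) : Type _ := RingQuot (HeckeRel cs u)

instance (cs : CoxeterSystem M W) (u : B → k) : Ring (HeckeAlg cs u) :=
  inferInstanceAs (Ring (RingQuot (HeckeRel cs u)))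

instance (cs : CoxeterSystem M W) (u : B → k) : Algebra k (HeckeAlg cs u) :=
  inferInstanceAs (Algebra k (RingQuot (HeckeRel cs u)))

/-- The generator `T_s` of `H_W(u)` for `s = s_i`. -/
def T (cs : CoxeterSystem M W) (u : B → k) (i : B) : HeckeAlg cs u :=
  RingQuot.mkAlgHom k (HeckeRel cs u) (FreeAlgebra.ι k i)

/-- The product `T_{s_1} ⋯ T_{s_r}` along a word; for a reduced expression of `w`
it is the element `T_w`. -/
def TWord (cs : CoxeterSystem M W) (u : B → k) (ω : List B) : HeckeAlg cs u :=
  (ω.map (T cs u)).prod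

/-! ### The extended algebra -/

/-- The generators `g_s` (`s ∈ S`) and `e_t` (`t ∈ R`). -/
inductive Gen (cs : CoxeterSystem M W) : Type _
  | g (i : B) : Gen cs
  | e (t : Refl cs) : Gen cs

/-- The generator `g_s` in the free algebra. -/
abbrev fg (k : Type*) [CommRing k] (cs : CoxeterSystem M W) (i : B) : FreeAlgebra k (Gen cs) :=
  FreeAlgebra.ι k (Gen.g i)

/-- The generator `e_t` in the free algebra. -/
abbrev fe (k : Type*) [CommRing k] (cs : CoxeterSystem M W) (t : Refl cs) :
    FreeAlgebra k (Gen cs) :=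
  FreeAlgebra.ι k (Gen.e t)

/-- The six families of defining relations of `C_W(u)`. -/
inductive ExtRel (cs : CoxeterSystem M W) (u : B → k) :
    FreeAlgebra k (Gen cs) → FreeAlgebra k (Gen cs) → Prop
  | braid (i j : B) : ExtRel cs u
      ((CoxeterSystem.braidWord M i j).map (fg k cs)).prod
      ((CoxeterSystem.braidWord M j i).map (fg k cs)).prod
  | idem (t : Refl cs) : ExtRel cs u (fe k cs t ^ 2) (fe k cs t)
  | comm (t t' : Refl cs) : ExtRel cs u (fe k cs t * fe k cs t') (fe k cs t' * fe k cs t)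
  | conj (t t' : Refl cs) : ExtRel cs u
      (fe k cs t * fe k cs t') (fe k cs t * fe k cs (conjRefl t.1 t'))
  | act (i : B) (t : Refl cs) : ExtRel cs u
      (fg k cs i * fe k cs t) (fe k cs (conjRefl (cs.simple i) t) * fg k cs i)
  | quad (i : B) : ExtRel cs u
      (fg k cs i ^ 2)
      (1 + algebraMap k _ (u i - 1) * fe k cs (simpleRefl cs i) * (1 + fg k cs i))

/-- The algebra `C_W(u)`. -/
def ExtAlg (cs : CoxeterSystem M W) (u : B → k) : Type _ := RingQuot (ExtRel cs u)

instance (cs : CoxeterSystem M W) (u : B → k) : Ring (ExtAlg cs u) :=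
  inferInstanceAs (Ring (RingQuot (ExtRel cs u)))

instance (cs : CoxeterSystem M W) (u : B → k) : Algebra k (ExtAlg cs u) :=
  inferInstanceAs (Algebra k (RingQuot (ExtRel cs u)))

/-- The generator `g_s` of `C_W(u)` for `s = s_i`. -/
def g (cs : CoxeterSystem M W) (u : B → k) (i : B) : ExtAlg cs u :=
  RingQuot.mkAlgHom k (ExtRel cs u) (fg k cs i)

/-- The generator `e_t` of `C_W(u)`. -/
def e (cs : CoxeterSystem M W) (u : B → k) (t : Refl cs) : ExtAlg cs u :=
  RingQuot.mkAlgHom k (ExtRel cs u) (fe k cs t)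

/-- The product `g_{s_1} ⋯ g_{s_r}` along a word; for a reduced expression of `w`
it is the element `g_w`. -/
def gWord (cs : CoxeterSystem M W) (u : B → k) (ω : List B) : ExtAlg cs u :=
  (ω.map (g cs u)).prod

theorem e_commute (cs : CoxeterSystem M W) (u : B → k) (t t' : Refl cs) :
    Commute (e cs u t) (e cs u t') := by
  have h := RingQuot.mkAlgHom_rel k (ExtRel.comm (u := u) t t')
  rw [map_mul, map_mul] at h
  exact h

/-- The element `e_J = ∏_{t ∈ J} e_t` for a finite set `J` of reflections. -/
def eSet (cs : CoxeterSystem M W) (u : B → k) (J : Finset (Refl cs)) : ExtAlg cs u :=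
  J.noncommProd (e cs u) fun _ _ _ _ _ => e_commute cs u _ _

/-- The finite set `S` of simple reflections (for finite `S`). -/
def simpleSet (cs : CoxeterSystem M W) [Finite B] : Finset (Refl cs) :=
  (Set.finite_range (simpleRefl cs)).toFinset

end ExtHecke

end

noncomputable section

namespace ExtHecke

variable {k : Type*} [CommRing k] {B : Type*} {M : CoxeterMatrix B} {W : Type*} [Group W]

/-! ### Conjugation of reflections -/

section Refl

variable {cs : CoxeterSystem M W}

/-! Setting every `e_t` to `1` turns the relations of `C_W(u)` into those of `H_W(u)`, which gives
`p`. It suffices to kill the `e_s - 1`: once `e_s = 1`, relation 4 reads `e_t = e_{sts}`, and every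
reflection is conjugate to a simple one. Hence any quotient of `C_W(u)` in which all `e_s` become
`1` receives a map from `H_W(u)`, which determines the kernel (`ker_le_of_e_sub_one_mem`).

For the splitting, let `J` generate `W`. Relation 4 makes `e_t e_J` depend only on the conjugacy
class of `t`, and a sign character shows that `J` meets every class of reflections. So `e_J` absorbs
all `e_t` (`e_mul_eSet`); it is therefore independent of `J`, idempotent and central. Its
annihilator is then a two-sided ideal containing `ker p`, so `p x ↦ x e_J` is well defined, and this
is `q`. -/

theorem conjRefl_one (t : Refl cs) : conjRefl 1 t = t := Subtype.ext (by simp [conjRefl])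

theorem conjRefl_mul (v w : W) (t : Refl cs) :
    conjRefl (v * w) t = conjRefl v (conjRefl w t) :=
  Subtype.ext (by simp [conjRefl, mul_assoc])

theorem exists_eq_conjRefl_simpleRefl (t : Refl cs) :
    ∃ (w : W) (i : B), t = conjRefl w (simpleRefl cs i) := by
  obtain ⟨t, w, i, rfl⟩ := t
  exact ⟨w, i, rfl⟩

theorem conjRefl_simple_conjRefl_simple (i : B) (t : Refl cs) :
    conjRefl (cs.simple i) (conjRefl (cs.simple i) t) = t := by
  rw [← conjRefl_mul, cs.simple_mul_simple_self, conjRefl_one]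

/-- If `m_{ij}` is odd, then `s_i` and `s_j` are conjugate. -/
theorem isConj_simple_of_odd (cs : CoxeterSystem M W) {i j : B} (h : Odd (M i j)) :
    IsConj (cs.simple i) (cs.simple j) := by
  obtain ⟨m, hm⟩ := h
  have hpow := cs.simple_mul_simple_pow i j
  rw [hm, pow_succ, two_mul, pow_add] at hpow
  -- In the dihedral group, `s_i` inverts the rotation `s_i s_j`.
  have hsemi : ∀ n : ℕ, cs.simple i * ((cs.simple i * cs.simple j) ^ n)⁻¹
      = (cs.simple i * cs.simple j) ^ n * cs.simple i := by
    intro n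
    have h1 : SemiconjBy (cs.simple i) (cs.simple i * cs.simple j)⁻¹
        (cs.simple i * cs.simple j) := by
      simp [SemiconjBy, mul_assoc]
    simpa only [SemiconjBy, inv_pow] using h1.pow_right n
  refine isConj_iff.2 ⟨(cs.simple i * cs.simple j) ^ m, ?_⟩
  rw [mul_assoc, hsemi, ← mul_assoc]
  rw [← mul_assoc] at hpow
  exact (eq_inv_of_mul_eq_one_left hpow).trans (by simp)

open Classical in
/-- The sign character attached to the conjugacy class of `s_i`: it maps the simple reflections
that are conjugate to `s_i` to `-1`, and the other ones to `1`. -/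
theorem exists_conjClass_sign (cs : CoxeterSystem M W) (i : B) :
    ∃ χ : W →* ℤˣ, ∀ j, χ (cs.simple j) = if IsConj (cs.simple i) (cs.simple j) then -1 else 1 := by
  let f : B → ℤˣ := fun j => if IsConj (cs.simple i) (cs.simple j) then -1 else 1
  have hf : M.IsLiftable f := by
    intro j l
    by_cases hodd : Odd (M j l)
    · have hjl : f j = f l := by
        have := isConj_simple_of_odd cs hodd
        simp only [f]
        congr 1
        exact propext ⟨fun h => h.trans this, fun h => h.trans this.symm⟩
      rw [hjl, Int.units_mul_self, one_pow]
    -- This case includes `M j l = 0`, the encoding of infinite order.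
    · obtain ⟨n, hn⟩ := Nat.not_odd_iff_even.1 hodd
      rw [hn, ← two_mul, pow_mul, Int.units_sq, one_pow]
  exact ⟨cs.lift ⟨f, hf⟩, fun j => cs.lift_apply_simple hf j⟩

/-- A set of reflections generating `W` meets every conjugacy class of reflections. -/
theorem exists_conjRefl_mem_of_closure_eq_top {J : Finset (Refl cs)}
    (hJ : Subgroup.closure {w : W | ∃ t ∈ J, t.1 = w} = ⊤) (t : Refl cs) :
    ∃ w : W, conjRefl w t ∈ J := by
  classical
  obtain ⟨v, i, rfl⟩ := exists_eq_conjRefl_simpleRefl t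
  obtain ⟨χ, hχ⟩ := exists_conjClass_sign cs i
  suffices h : ∃ r ∈ J, χ r.1 ≠ 1 by
    obtain ⟨r, hr, hr1⟩ := h
    obtain ⟨w, j, rfl⟩ := exists_eq_conjRefl_simpleRefl r
    have hconj : IsConj (cs.simple i) (cs.simple j) := by
      by_contra hn
      apply hr1
      change χ (w * cs.simple j * w⁻¹) = 1
      rw [map_mul, map_mul, hχ, if_neg hn, mul_one, ← map_mul, mul_inv_cancel, map_one]
    obtain ⟨c, hc⟩ := isConj_iff.1 hconj
    refine ⟨w * c * v⁻¹, ?_⟩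
    convert hr using 1
    rw [← conjRefl_mul, inv_mul_cancel_right, conjRefl_mul]
    exact congrArg _ (Subtype.ext hc)
  -- Otherwise the generating set `J` lies in the kernel of `χ`, although `χ (s_i) = -1`.
  by_contra! hn
  have hle : Subgroup.closure {w : W | ∃ t ∈ J, t.1 = w} ≤ χ.ker := by
    rw [Subgroup.closure_le]
    rintro _ ⟨r, hr, rfl⟩
    exact hn r hr
  have hi : cs.simple i ∈ χ.ker := hle (hJ ▸ Subgroup.mem_top _)
  rw [MonoidHom.mem_ker, hχ, if_pos (IsConj.refl _)] at hi
  exact absurd hi (by decide)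

theorem closure_simpleSet (cs : CoxeterSystem M W) [Finite B] :
    Subgroup.closure {w : W | ∃ t ∈ simpleSet cs, t.1 = w} = ⊤ := by
  rw [← cs.subgroup_closure_range_simple]
  congr 1
  ext w
  simp [simpleSet, simpleRefl]

end Refl

/-! ### Relations in the two algebras -/

section Relations

variable (cs : CoxeterSystem M W) (u : B → k)

theorem T_braid (i j : B) :
    ((CoxeterSystem.braidWord M i j).map (T cs u)).prod =
      ((CoxeterSystem.braidWord M j i).map (T cs u)).prod := by
  have h := RingQuot.mkAlgHom_rel k (HeckeRel.braid (cs := cs) (u := u) i j)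
  rw [map_list_prod, map_list_prod, List.map_map, List.map_map] at h
  exact h

theorem T_sq (i : B) :
    T cs u i ^ 2 = algebraMap k _ (u i) + algebraMap k _ (u i - 1) * T cs u i := by
  have h := RingQuot.mkAlgHom_rel k (HeckeRel.quad (cs := cs) (u := u) i)
  rw [map_pow, map_add, map_mul, AlgHom.commutes, AlgHom.commutes] at h
  exact h

theorem g_braid (i j : B) :
    ((CoxeterSystem.braidWord M i j).map (g cs u)).prod =
      ((CoxeterSystem.braidWord M j i).map (g cs u)).prod := by
  have h := RingQuot.mkAlgHom_rel k (ExtRel.braid (cs := cs) (u := u) i j)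
  rw [map_list_prod, map_list_prod, List.map_map, List.map_map] at h
  exact h

theorem e_mul_self (t : Refl cs) : e cs u t * e cs u t = e cs u t := by
  have h := RingQuot.mkAlgHom_rel k (ExtRel.idem (u := u) t)
  rw [map_pow, sq] at h
  exact h

theorem e_mul_e_conjRefl (t t' : Refl cs) :
    e cs u t * e cs u t' = e cs u t * e cs u (conjRefl t.1 t') := by
  have h := RingQuot.mkAlgHom_rel k (ExtRel.conj (u := u) t t')
  rw [map_mul, map_mul] at h
  exact h

theorem g_mul_e (i : B) (t : Refl cs) :
    g cs u i * e cs u t = e cs u (conjRefl (cs.simple i) t) * g cs u i := by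
  have h := RingQuot.mkAlgHom_rel k (ExtRel.act (u := u) i t)
  rw [map_mul, map_mul] at h
  exact h

theorem e_mul_g (i : B) (t : Refl cs) :
    e cs u t * g cs u i = g cs u i * e cs u (conjRefl (cs.simple i) t) := by
  rw [g_mul_e, conjRefl_simple_conjRefl_simple]

theorem g_sq (i : B) :
    g cs u i ^ 2 =
      1 + algebraMap k _ (u i - 1) * e cs u (simpleRefl cs i) * (1 + g cs u i) := by
  have h := RingQuot.mkAlgHom_rel k (ExtRel.quad (cs := cs) (u := u) i)
  rw [map_pow, map_add, map_mul, map_mul, map_add, map_one, AlgHom.commutes] at h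
  exact h

variable {cs u}

/-- `C_W(u)` is generated by the `g_s` and the `e_t`. -/
theorem ExtAlg.mem_of_generators_mem (A : Subalgebra k (ExtAlg cs u)) (hg : ∀ i, g cs u i ∈ A)
    (he : ∀ t, e cs u t ∈ A) (x : ExtAlg cs u) : x ∈ A := by
  obtain ⟨y, rfl⟩ := RingQuot.mkAlgHom_surjective k (ExtRel cs u) x
  induction y using FreeAlgebra.induction with
  | grade0 r => rw [AlgHom.commutes]; exact A.algebraMap_mem r
  | grade1 y =>
    cases y with
    | g i => exact hg i
    | e t => exact he t
  | mul a b ha hb => rw [map_mul]; exact A.mul_mem ha hb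
  | add a b ha hb => rw [map_add]; exact A.add_mem ha hb

/-- `H_W(u)` is generated by the `T_s`. -/
theorem HeckeAlg.mem_of_generators_mem (A : Subalgebra k (HeckeAlg cs u))
    (hT : ∀ i, T cs u i ∈ A) (x : HeckeAlg cs u) : x ∈ A := by
  obtain ⟨y, rfl⟩ := RingQuot.mkAlgHom_surjective k (HeckeRel cs u) x
  induction y using FreeAlgebra.induction with
  | grade0 r => rw [AlgHom.commutes]; exact A.algebraMap_mem r
  | grade1 i => exact hT i
  | mul a b ha hb => rw [map_mul]; exact A.mul_mem ha hb
  | add a b ha hb => rw [map_add]; exact A.add_mem ha hb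

theorem ExtAlg.algHom_ext {A : Type*} [Semiring A] [Algebra k A] {f f' : ExtAlg cs u →ₐ[k] A}
    (hg : ∀ i, f (g cs u i) = f' (g cs u i)) (he : ∀ t, f (e cs u t) = f' (e cs u t)) : f = f' :=
  AlgHom.ext (ExtAlg.mem_of_generators_mem (AlgHom.equalizer f f') hg he)

/-- An algebra morphism that maps all `e_s`, `s ∈ S`, to `1` maps all `e_t` to `1`. -/
theorem ExtAlg.map_e_eq_one {A : Type*} [Semiring A] [Algebra k A] (f : ExtAlg cs u →ₐ[k] A)
    (h : ∀ i, f (e cs u (simpleRefl cs i)) = 1) (t : Refl cs) : f (e cs u t) = 1 := by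
  obtain ⟨w, j, rfl⟩ := exists_eq_conjRefl_simpleRefl t
  induction w using cs.simple_induction_left with
  | one => rw [conjRefl_one, h]
  | mul_simple_left w i hw =>
    -- Under `f`, relation 4 with `t = s_i` loses its factor `e_{s_i}`.
    have h1 := congrArg f (e_mul_e_conjRefl cs u (simpleRefl cs i) (conjRefl w (simpleRefl cs j)))
    rw [map_mul, map_mul, h, one_mul, one_mul, hw] at h1
    rw [conjRefl_mul]
    exact h1.symm

theorem HeckeAlg.exists_lift {A : Type*} [Ring A] [Algebra k A] (a : B → A)
    (hbraid : ∀ i j, ((CoxeterSystem.braidWord M i j).map a).prod =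
      ((CoxeterSystem.braidWord M j i).map a).prod)
    (hquad : ∀ i, a i ^ 2 = algebraMap k A (u i) + algebraMap k A (u i - 1) * a i) :
    ∃ f : HeckeAlg cs u →ₐ[k] A, ∀ i, f (T cs u i) = a i := by
  have hw : ∀ ⦃x y⦄, HeckeRel cs u x y → FreeAlgebra.lift k a x = FreeAlgebra.lift k a y := by
    rintro _ _ (⟨i, j⟩ | ⟨i⟩)
    · have hcomp : FreeAlgebra.lift k a ∘ FreeAlgebra.ι k = a := FreeAlgebra.ι_comp_lift a
      simpa only [map_list_prod, List.map_map, hcomp] using hbraid i j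
    · simpa only [map_pow, map_add, map_mul, AlgHom.commutes, FreeAlgebra.lift_ι_apply]
        using hquad i
  refine ⟨RingQuot.liftAlgHom k ⟨FreeAlgebra.lift k a, hw⟩, fun i => ?_⟩
  exact (RingQuot.liftAlgHom_mkAlgHom_apply _ _ hw _).trans (FreeAlgebra.lift_ι_apply _ _)

variable (cs u)

theorem exists_extAlg_to_heckeAlg : ∃ p : ExtAlg cs u →ₐ[k] HeckeAlg cs u,
    (∀ i, p (g cs u i) = T cs u i) ∧ ∀ t, p (e cs u t) = 1 := by
  let a : Gen cs → HeckeAlg cs u := fun x => Gen.rec (T cs u) (fun _ => 1) x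
  have hg : ∀ i, FreeAlgebra.lift k a (fg k cs i) = T cs u i :=
    fun i => FreeAlgebra.lift_ι_apply _ _
  have he : ∀ t, FreeAlgebra.lift k a (fe k cs t) = 1 := fun t => FreeAlgebra.lift_ι_apply _ _
  have hw : ∀ ⦃x y⦄, ExtRel cs u x y → FreeAlgebra.lift k a x = FreeAlgebra.lift k a y := by
    rintro _ _ (⟨i, j⟩ | ⟨t⟩ | ⟨t, t'⟩ | ⟨t, t'⟩ | ⟨i, t⟩ | ⟨i⟩)
    · have hcomp : FreeAlgebra.lift k a ∘ fg k cs = T cs u := funext hg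
      simpa only [map_list_prod, List.map_map, hcomp] using T_braid cs u i j
    · simp only [map_pow, he, one_pow]
    · simp only [map_mul, he]
    · simp only [map_mul, he]
    · simp only [map_mul, he, hg, one_mul, mul_one]
    · simp only [map_pow, map_add, map_mul, map_one, he, hg, AlgHom.commutes, T_sq, map_sub]
      noncomm_ring
  refine ⟨RingQuot.liftAlgHom k ⟨FreeAlgebra.lift k a, hw⟩, fun i => ?_, fun t => ?_⟩
  · exact (RingQuot.liftAlgHom_mkAlgHom_apply _ _ hw _).trans (hg i)
  · exact (RingQuot.liftAlgHom_mkAlgHom_apply _ _ hw _).trans (he t)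

variable {cs u}

/-- A two-sided ideal containing all `e_s - 1` contains the kernel of `C_W(u) → H_W(u)`. -/
theorem ker_le_of_e_sub_one_mem {p : ExtAlg cs u →ₐ[k] HeckeAlg cs u}
    (hg : ∀ i, p (g cs u i) = T cs u i) (he : ∀ t, p (e cs u t) = 1)
    (I : TwoSidedIdeal (ExtAlg cs u)) (hI : ∀ i, e cs u (simpleRefl cs i) - 1 ∈ I) :
    TwoSidedIdeal.ker p ≤ I := by
  let π : ExtAlg cs u →ₐ[k] I.ringCon.Quotient :=
    { I.ringCon.mk' with commutes' := fun _ => rfl }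
  have hπ : ∀ x y, π x = π y ↔ x - y ∈ I := fun x y => by
    rw [← TwoSidedIdeal.rel_iff]
    exact RingCon.eq _
  have hπe : ∀ t, π (e cs u t) = 1 :=
    ExtAlg.map_e_eq_one π fun i => by rw [← map_one π, hπ]; exact hI i
  obtain ⟨f, hf⟩ := HeckeAlg.exists_lift (cs := cs) (u := u) (fun i => π (g cs u i))
    (fun i j => by
      simpa only [map_list_prod, List.map_map, Function.comp_def] using
        congrArg π (g_braid cs u i j))
    (fun i => by
      have h := congrArg π (g_sq cs u i)
      simp only [map_pow, map_add, map_mul, map_one, hπe, AlgHom.commutes] at h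
      rw [h, map_sub]
      simp only [map_one]
      noncomm_ring)
  -- The projection `π` factors through `p`, so its kernel `I` contains that of `p`.
  have hfp : f.comp p = π := ExtAlg.algHom_ext
    (fun i => by rw [AlgHom.comp_apply, hg, hf])
    (fun t => by rw [AlgHom.comp_apply, he, map_one, hπe])
  intro x hx
  rw [TwoSidedIdeal.mem_ker] at hx
  rw [← sub_zero x, ← hπ, map_zero, ← hfp, AlgHom.comp_apply, hx, map_zero]

end Relations

/-! ### The idempotents `e_J` -/

section ESet

variable {cs : CoxeterSystem M W} {u : B → k}

theorem eSet_cons (J : Finset (Refl cs)) (t : Refl cs) (ht : t ∉ J) :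
    eSet cs u (J.cons t ht) = e cs u t * eSet cs u J :=
  Finset.noncommProd_cons _ _ _ _ _

theorem e_commute_eSet (J : Finset (Refl cs)) (t : Refl cs) :
    Commute (e cs u t) (eSet cs u J) :=
  Finset.noncommProd_commute _ _ _ _ fun _ _ => e_commute cs u _ _

theorem eSet_commute (J J' : Finset (Refl cs)) : Commute (eSet cs u J) (eSet cs u J') :=
  (Finset.noncommProd_commute _ _ _ _ fun _ _ => (e_commute_eSet J _).symm)

theorem e_mul_eSet_of_mem {J : Finset (Refl cs)} {t : Refl cs} (ht : t ∈ J) :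
    e cs u t * eSet cs u J = eSet cs u J := by
  classical
  rw [← Finset.insert_erase ht, ← Finset.cons_eq_insert _ _ (Finset.notMem_erase t J), eSet_cons,
    ← mul_assoc, e_mul_self]

/-- For `w = r ∈ J`, split a factor `e_r` off `e_J` and apply relation 4; the general case follows
by composing conjugations. -/
theorem e_conjRefl_mul_eSet {J : Finset (Refl cs)} {w : W}
    (hw : w ∈ Subgroup.closure {w : W | ∃ t ∈ J, t.1 = w}) (t : Refl cs) :
    e cs u (conjRefl w t) * eSet cs u J = e cs u t * eSet cs u J := by
  have key : ∀ r ∈ J, ∀ t, e cs u (conjRefl r.1 t) * eSet cs u J = e cs u t * eSet cs u J := by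
    intro r hr t
    rw [← e_mul_eSet_of_mem hr, ← mul_assoc, ← mul_assoc, (e_commute cs u _ r).eq,
      (e_commute cs u t r).eq, ← e_mul_e_conjRefl]
  induction hw using Subgroup.closure_induction generalizing t with
  | mem x hx => obtain ⟨r, hr, rfl⟩ := hx; exact key r hr t
  | one => rw [conjRefl_one]
  | mul x y _ _ hx hy => rw [conjRefl_mul, hx, hy]
  | inv x _ hx => rw [← hx, ← conjRefl_mul, mul_inv_cancel, conjRefl_one]

/-- If `J` generates `W`, then `e_J` absorbs all the `e_t`. -/
theorem e_mul_eSet {J : Finset (Refl cs)}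
    (hJ : Subgroup.closure {w : W | ∃ t ∈ J, t.1 = w} = ⊤) (t : Refl cs) :
    e cs u t * eSet cs u J = eSet cs u J := by
  obtain ⟨w, hw⟩ := exists_conjRefl_mem_of_closure_eq_top hJ t
  rw [← e_conjRefl_mul_eSet (w := w) (hJ ▸ Subgroup.mem_top _), e_mul_eSet_of_mem hw]

theorem eSet_mul_eSet {J : Finset (Refl cs)}
    (hJ : Subgroup.closure {w : W | ∃ t ∈ J, t.1 = w} = ⊤) (J' : Finset (Refl cs)) :
    eSet cs u J' * eSet cs u J = eSet cs u J := by
  induction J' using Finset.cons_induction with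
  | empty => exact one_mul _
  | cons t J' ht ih => rw [eSet_cons, mul_assoc, ih, e_mul_eSet hJ]

/-- Each of the two commuting elements absorbs the other. -/
theorem eSet_eq_eSet {J J' : Finset (Refl cs)}
    (hJ : Subgroup.closure {w : W | ∃ t ∈ J, t.1 = w} = ⊤)
    (hJ' : Subgroup.closure {w : W | ∃ t ∈ J', t.1 = w} = ⊤) :
    eSet cs u J = eSet cs u J' := by
  rw [← eSet_mul_eSet hJ' J, (eSet_commute J J').eq, eSet_mul_eSet hJ]

/-- Both products equal `e_J g_s e_J`: moving an `e_t` across `g_s` gives `e_{sts}`, which `e_J`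
absorbs. -/
theorem g_commute_eSet {J : Finset (Refl cs)}
    (hJ : Subgroup.closure {w : W | ∃ t ∈ J, t.1 = w} = ⊤) (i : B) :
    Commute (g cs u i) (eSet cs u J) := by
  have hl : ∀ J', eSet cs u J' * (g cs u i * eSet cs u J) = g cs u i * eSet cs u J := by
    intro J'
    induction J' using Finset.cons_induction with
    | empty => exact one_mul _
    | cons t J' ht ih =>
      rw [eSet_cons, mul_assoc, ih, ← mul_assoc, e_mul_g, mul_assoc, e_mul_eSet hJ]
  have hr : ∀ J', eSet cs u J * g cs u i * eSet cs u J' = eSet cs u J * g cs u i := by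
    intro J'
    induction J' using Finset.cons_induction with
    | empty => exact mul_one _
    | cons t J' ht ih =>
      rw [eSet_cons, (e_commute_eSet J' t).eq, ← mul_assoc, ih, mul_assoc, g_mul_e, ← mul_assoc,
        ← (e_commute_eSet J _).eq, e_mul_eSet hJ]
  exact (hl J).symm.trans ((mul_assoc _ _ _).symm.trans (hr J))

/-- If `J` generates `W`, then `e_J` is central. -/
theorem commute_eSet {J : Finset (Refl cs)}
    (hJ : Subgroup.closure {w : W | ∃ t ∈ J, t.1 = w} = ⊤) (x : ExtAlg cs u) :
    Commute x (eSet cs u J) :=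
  (ExtAlg.mem_of_generators_mem (Subalgebra.centralizer k {eSet cs u J})
    (fun i => Subalgebra.mem_centralizer_iff k |>.2 fun _ h => by
      rw [Set.mem_singleton_iff.1 h]; exact (g_commute_eSet hJ i).symm)
    (fun t => Subalgebra.mem_centralizer_iff k |>.2 fun _ h => by
      rw [Set.mem_singleton_iff.1 h]; exact (e_commute_eSet J t).symm) x _ rfl).symm

/-- If `J` generates `W`, then `x e_J` only depends on the image of `x` in `H_W(u)`. -/
theorem mul_eSet_eq_of_map_eq {p : ExtAlg cs u →ₐ[k] HeckeAlg cs u}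
    (hg : ∀ i, p (g cs u i) = T cs u i) (he : ∀ t, p (e cs u t) = 1) {J : Finset (Refl cs)}
    (hJ : Subgroup.closure {w : W | ∃ t ∈ J, t.1 = w} = ⊤) {x y : ExtAlg cs u} (h : p x = p y) :
    x * eSet cs u J = y * eSet cs u J := by
  -- The annihilator of `e_J`; closure under right multiplication uses that `e_J` is central.
  let I : TwoSidedIdeal (ExtAlg cs u) := TwoSidedIdeal.mk' {z | z * eSet cs u J = 0}
    (zero_mul _)
    (fun {a b} ha hb => by
      rw [Set.mem_ofPred_eq] at ha hb ⊢
      rw [add_mul, ha, hb, add_zero])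
    (fun {a} ha => by
      rw [Set.mem_ofPred_eq] at ha ⊢
      rw [neg_mul, ha, neg_zero])
    (fun {a b} hb => by
      rw [Set.mem_ofPred_eq] at hb ⊢
      rw [mul_assoc, hb, mul_zero])
    (fun {a b} ha => by
      rw [Set.mem_ofPred_eq] at ha ⊢
      rw [mul_assoc, (commute_eSet hJ b).eq, ← mul_assoc, ha, zero_mul])
  have hmem : ∀ z, z ∈ I ↔ z * eSet cs u J = 0 := fun z => TwoSidedIdeal.mem_mk' _ _ _ _ _ _ z
  have hxy : x - y ∈ I := ker_le_of_e_sub_one_mem hg he I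
    (fun i => by rw [hmem, sub_mul, e_mul_eSet hJ, one_mul, sub_self])
    ((TwoSidedIdeal.mem_ker p).2 (by rw [map_sub, h, sub_self]))
  rwa [hmem, sub_mul, sub_eq_zero] at hxy

end ESet

end ExtHecke

end

open ExtHecke in
theorem mainTheorem3 {k : Type*} [CommRing k] {B : Type*} {M : CoxeterMatrix B}
    {W : Type*} [Group W] (cs : CoxeterSystem M W) (u : B → k)
    (hu : ∀ i j : B, IsConj (cs.simple i) (cs.simple j) → u i = u j) :
    ∃ p : ExtAlg cs u →ₐ[k] HeckeAlg cs u,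
      -- `p` is the morphism induced by `g_s ↦ T_s`, `e_s ↦ 1`
      ((∀ i, p (g cs u i) = T cs u i) ∧ (∀ i, p (e cs u (simpleRefl cs i)) = 1)) ∧
      (∀ p' : ExtAlg cs u →ₐ[k] HeckeAlg cs u,
        (∀ i, p' (g cs u i) = T cs u i) → (∀ i, p' (e cs u (simpleRefl cs i)) = 1) → p' = p) ∧
      Function.Surjective p ∧
      -- `p (g_w) = T_w`, for every reduced expression of `w`
      (∀ ω : List B, cs.IsReduced ω → p (gWord cs u ω) = TWord cs u ω) ∧
      (∀ J : Finset (Refl cs), p (eSet cs u J) = 1) ∧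
      TwoSidedIdeal.ker p =
        TwoSidedIdeal.span (Set.range fun i : B => e cs u (simpleRefl cs i) - 1) ∧
      -- the splitting, for finite `S`
      (∀ [Finite B],
        (∀ J : Finset (Refl cs), Subgroup.closure {w : W | ∃ t ∈ J, t.1 = w} = ⊤ →
          eSet cs u J = eSet cs u (simpleSet cs)) ∧
        ∃ q : HeckeAlg cs u →ₙₐ[k] ExtAlg cs u,
          (∀ x, p (q x) = x) ∧
          ∀ ω : List B, cs.IsReduced ω →
            q (TWord cs u ω) = gWord cs u ω * eSet cs u (simpleSet cs)) := by
  obtain ⟨p, hg, he⟩ := exists_extAlg_to_heckeAlg cs u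
  have hsurj : Function.Surjective p := fun x =>
    HeckeAlg.mem_of_generators_mem p.range (fun i => ⟨g cs u i, hg i⟩) x
  have hword : ∀ ω : List B, p (gWord cs u ω) = TWord cs u ω := fun ω => by
    simp only [gWord, TWord, map_list_prod, List.map_map, Function.comp_def, hg]
  have heSet : ∀ J : Finset (Refl cs), p (eSet cs u J) = 1 := by
    intro J
    induction J using Finset.cons_induction with
    | empty => exact map_one p
    | cons t J ht ih => rw [eSet_cons, map_mul, he, ih, one_mul]
  refine ⟨p, ⟨hg, fun i => he _⟩, fun p' hg' he' => ?_, hsurj, fun ω _ => hword ω, heSet, ?_, ?_⟩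
  · exact ExtAlg.algHom_ext (fun i => by rw [hg, hg'])
      fun t => by rw [he, ExtAlg.map_e_eq_one p' he']
  · apply le_antisymm
    · exact ker_le_of_e_sub_one_mem hg he _ fun i => TwoSidedIdeal.subset_span ⟨i, rfl⟩
    · rw [TwoSidedIdeal.span_le]
      rintro _ ⟨i, rfl⟩
      exact (TwoSidedIdeal.mem_ker p).2 (by rw [map_sub, he, map_one, sub_self])
  · intro _
    have hS := closure_simpleSet cs
    refine ⟨fun J hJ => eSet_eq_eSet hJ hS, ?_⟩
    have hwd : ∀ {x y}, p x = p y → x * eSet cs u (simpleSet cs) = y * eSet cs u (simpleSet cs) :=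
      mul_eSet_eq_of_map_eq hg he hS
    -- A mere set-theoretic section: multiplying by `e_S` removes the dependence on the choice, so
    -- linearity and multiplicativity can be checked after applying `p`.
    obtain ⟨σ, hσ⟩ := hsurj.hasRightInverse
    refine ⟨{ toFun := fun x => σ x * eSet cs u (simpleSet cs)
              map_smul' := fun c x => ?_
              map_zero' := ?_
              map_add' := fun x y => ?_
              map_mul' := fun x y => ?_ }, fun x => ?_, fun ω _ => ?_⟩
    · rw [MonoidHom.id_apply, ← smul_mul_assoc]
      exact hwd (by rw [map_smul, hσ, hσ])
    · rw [← zero_mul (eSet cs u (simpleSet cs))]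
      exact hwd (by rw [map_zero, hσ])
    · rw [← add_mul]
      exact hwd (by rw [map_add, hσ, hσ, hσ])
    -- As `e_S` is central and idempotent, its two copies merge at the right.
    · rw [mul_assoc, ← mul_assoc _ (σ y), ← (commute_eSet hS (σ y)).eq, mul_assoc (σ y),
        eSet_mul_eSet hS, ← mul_assoc]
      exact hwd (by rw [map_mul, hσ, hσ, hσ])
    · change p (σ x * eSet cs u (simpleSet cs)) = x
      rw [map_mul, heSet, mul_one, hσ]
    · exact hwd (by rw [hσ, hword])
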